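/- An L-algebra is a set $X$ with a binary operation $\cdot$ and an element $1$ such that $1\cdot x=x$, $x\cdot 1=x\cdot x=1$, $(x\cdot y)\cdot(x\cdot z)=(y\cdot x)\cdot(y\cdot z)$, and $x\cdot y=y\cdot x=1$ implies $x=y$; it is ordered by $x\le y\iff x\cdot y=1$. It is self-similar if for every $x$ the map $y\mapsto x\cdot y$ restricts to a bijection from $\{y\mid y\le x\}$ onto $X$; it is then a monoid, where $xy$ is the unique $z\le y$ with $y\cdot z=x$. A self-similar closure of $X$ is a self-similar L-algebra $S$ with an embedding $X\hookrightarrow S$ of L-algebras whose image generates $S$ as a monoid. Concretely, let $M(X)$ be the free monoid on $X$, with the operation extended uniquely from $X$ by $e\cdot a=a$ ($e$ the empty word), $ab\cdot c=a\cdot(b\cdot c)$ and $a\cdot bc=((c\cdot a)\cdot b)(a\cdot c)$; then the self-similar closure is $S(X)=M(X)/{\approx}$, where $a\approx b$ iff $(c\cdot a)\cdot d=(c\cdot b)\cdot d$ for all $c,d\in M(X)$. An L-algebra $Y$ operates on an L-algebra $X$ via $\rho:Y\to\mathrm{End}(X)$ if $\rho_1=\mathrm{id}$ and $\rho_{u\cdot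 v}\rho_u=\rho_{v\cdot u}\rho_v$ for all $u,v\in Y$. The semidirect product $X\rtimes_\rho Y$ is then the L-algebra on $X\times Y$ with $(x,u)\cdot(y,v)=(\rho_{u\cdot v}(x)\cdot\rho_{v\cdot u}(y),\,u\cdot v)$ and unit $(1,1)$. Theorem. Let $X$ and $Y$ be L-algebras such that $Y$ operates on $X$ via $\rho$. (1) There is a unique operation $\tilde\rho$ of $S(Y)$ on $S(X)$ that extends $\rho$, i.e. $\tilde\rho_u(x)=\rho_u(x)$ for all $u\in Y$, $x\in X$. (2) $S(X\rtimes_\rho Y)=S(X)\rtimes_{\tilde\rho}S(Y)$. That is, the L-algebra $S(X)\rtimes_{\tilde\rho}S(Y)$ with the natural map $X\rtimes_\rho Y\to S(X)\rtimes_{\tilde\rho}S(Y)$ is a self-similar closure of $X\rtimes_\rho Y$, and there is a unique isomorphism of L-algebras $S(X\rtimes_\rho Y)\to S(X)\rtimes_{\tilde\rho}S(Y)$ that is compatible with the natural maps from $X\rtimes_\rho Y$. (3) $X\rtimes_\rho Y$ is self-similar if and only if both $X$ and $Y$ are self-similar. -/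

import Mathlib

universe u v

/-- An L-algebra: a set with a binary operation `x ⇀ y` (written `x · y` on paper) and a
distinguished element `1`. -/
class LAlgebra (X : Type u) extends One X where
  op : X → X → X
  one_op : ∀ x : X, op 1 x = x
  op_one : ∀ x : X, op x 1 = 1
  op_self : ∀ x : X, op x x = 1
  cycle : ∀ x y z : X, op (op x y) (op x z) = op (op y x) (op y z)
  antisymm : ∀ x y : X, op x y = 1 → op y x = 1 → x = y

infixr:70 " ⇀ " => LAlgebra.op

namespace LAlgebra

/-- The downset `{y | y ≤ x}` of `x` for the natural order: `y ≤ x` iff `y ⇀ x = 1`. -/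
def downset {X : Type u} [LAlgebra X] (x : X) : Set X := {y | y ⇀ x = 1}

/-- `X` is self-similar if every left multiplication `σ_x : y ↦ x ⇀ y` restricts to a
bijection from the downset of `x` onto `X`. -/
def IsSelfSimilar (X : Type u) [LAlgebra X] : Prop :=
  ∀ x : X, Set.BijOn (fun y => x ⇀ y) (downset x) Set.univ

namespace IsSelfSimilar

variable {X : Type u} [LAlgebra X]

theorem exists_mul (h : IsSelfSimilar X) (x y : X) : ∃ z : X, z ⇀ y = 1 ∧ y ⇀ z = x := by
  obtain ⟨z, hz, hz'⟩ := (h y).surjOn (Set.mem_univ x)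
  exact ⟨z, hz, hz'⟩

/-- The product of a self-similar L-algebra: `x y` is the element `z ≤ y` with `y ⇀ z = x`. -/
noncomputable def mul (h : IsSelfSimilar X) (x y : X) : X := (h.exists_mul x y).choose

theorem mul_op_right (h : IsSelfSimilar X) (x y : X) : h.mul x y ⇀ y = 1 :=
  (h.exists_mul x y).choose_spec.1

theorem op_mul_self (h : IsSelfSimilar X) (x y : X) : y ⇀ h.mul x y = x :=
  (h.exists_mul x y).choose_spec.2

theorem eq_mul (h : IsSelfSimilar X) {x y z : X} (h1 : z ⇀ y = 1) (h2 : y ⇀ z = x) :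
    z = h.mul x y :=
  (h y).injOn h1 (h.mul_op_right x y) (h2.trans (h.op_mul_self x y).symm)

theorem mul_op (h : IsSelfSimilar X) (a b c : X) : h.mul a b ⇀ c = a ⇀ b ⇀ c := by
  have := cycle b (h.mul a b) c
  rw [h.op_mul_self, h.mul_op_right, one_op] at this
  exact this.symm

/-- The monoid structure of a self-similar L-algebra. -/
noncomputable abbrev monoid (h : IsSelfSimilar X) : Monoid X where
  mul := h.mul
  one := 1
  one_mul x := (h.eq_mul (op_self x) (op_self x)).symm
  mul_one x := (h.eq_mul (op_one x) (one_op x)).symm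
  mul_assoc a b c := by
    change h.mul (h.mul a b) c = h.mul a (h.mul b c)
    set w := h.mul a (h.mul b c) with hw
    have h1 : w ⇀ c = 1 := by rw [hw, h.mul_op, h.mul_op_right, op_one]
    have h2 : (c ⇀ w) ⇀ b = 1 := by
      have := cycle c w (h.mul b c)
      rwa [h.op_mul_self, h1, one_op, hw, h.mul_op_right] at this
    have h3 : b ⇀ c ⇀ w = a := by rw [← h.mul_op, hw, h.op_mul_self]
    exact (h.eq_mul h1 (h.eq_mul h2 h3)).symm

end IsSelfSimilar

/-- `f : X → S` exhibits `S` as a self-similar closure of `X`: `S` is a self-similar L-algebra,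
`f` is an embedding of L-algebras, and `f(X)` generates `S` as a monoid. -/
structure IsSelfSimilarClosure {X : Type u} {S : Type v} [LAlgebra X] [LAlgebra S]
    (f : X → S) : Prop where
  injective : Function.Injective f
  map_one : f 1 = 1
  map_op : ∀ x y : X, f (x ⇀ y) = f x ⇀ f y
  selfSimilar : IsSelfSimilar S
  generates : @Submonoid.closure S selfSimilar.monoid.toMulOneClass (Set.range f) = ⊤

/-- Morphisms of L-algebras (they preserve `1 = x ⇀ x` automatically). -/
@[ext]
structure Hom (X : Type u) (Y : Type v) [LAlgebra X] [LAlgebra Y] where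
  toFun : X → Y
  map_op : ∀ x y : X, toFun (x ⇀ y) = toFun x ⇀ toFun y

/-- Isomorphisms of L-algebras. -/
structure Iso (X : Type u) (Y : Type v) [LAlgebra X] [LAlgebra Y] extends X ≃ Y where
  map_op : ∀ x y : X, toFun (x ⇀ y) = toFun x ⇀ toFun y

theorem Hom.map_one {X : Type u} {Y : Type v} [LAlgebra X] [LAlgebra Y] (f : Hom X Y) :
    f.toFun 1 = 1 := by
  have := f.map_op 1 1
  rwa [op_self, op_self] at this

/-- `Operation Y X`: the ways in which the L-algebra `Y` operates on the L-algebra `X`, that is,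
the maps `ρ : Y → End(X)` with `ρ_1 = id` and `ρ_{u ⇀ v} ∘ ρ_u = ρ_{v ⇀ u} ∘ ρ_v`. -/
@[ext]
structure Operation (Y : Type v) (X : Type u) [LAlgebra Y] [LAlgebra X] where
  act : Y → Hom X X
  act_one : ∀ x : X, (act 1).toFun x = x
  act_comp : ∀ (u v : Y) (x : X),
    (act (u ⇀ v)).toFun ((act u).toFun x) = (act (v ⇀ u)).toFun ((act v).toFun x)

/-- The underlying set `X × Y` of the semidirect product of `X` and `Y` along `ρ`. -/
@[ext]
structure SemidirectProduct {X : Type u} {Y : Type v} [LAlgebra X] [LAlgebra Y]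
    (_ρ : Operation Y X) where
  fst : X
  snd : Y

namespace SemidirectProduct

variable {X : Type u} {Y : Type v} [LAlgebra X] [LAlgebra Y] (ρ : Operation Y X)

/-- `(x, u) · (y, v) = (ρ_{u · v}(x) · ρ_{v · u}(y), u · v)`. -/
instance : LAlgebra (SemidirectProduct ρ) where
  one := ⟨1, 1⟩
  op p q := ⟨(ρ.act (p.snd ⇀ q.snd)).toFun p.fst ⇀ (ρ.act (q.snd ⇀ p.snd)).toFun q.fst,
    p.snd ⇀ q.snd⟩
  one_op := by
    rintro ⟨x, u⟩
    change SemidirectProduct.mk ((ρ.act (1 ⇀ u)).toFun 1 ⇀ (ρ.act (u ⇀ 1)).toFun x) (1 ⇀ u) = _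
    rw [Hom.map_one, one_op, op_one, ρ.act_one, one_op]
  op_one := by
    rintro ⟨x, u⟩
    change SemidirectProduct.mk ((ρ.act (u ⇀ 1)).toFun x ⇀ (ρ.act (1 ⇀ u)).toFun 1) (u ⇀ 1) =
      ⟨1, 1⟩
    rw [Hom.map_one, op_one, op_one]
  op_self := by
    rintro ⟨x, u⟩
    change SemidirectProduct.mk ((ρ.act (u ⇀ u)).toFun x ⇀ (ρ.act (u ⇀ u)).toFun x) (u ⇀ u) =
      ⟨1, 1⟩
    rw [op_self, op_self]
  cycle := by
    rintro ⟨x, u⟩ ⟨y, v⟩ ⟨z, w⟩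
    ext
    · simp only [Hom.map_op]
      rw [ρ.act_comp (u ⇀ w) (u ⇀ v) x, cycle v w u, ρ.act_comp (w ⇀ v) (w ⇀ u) z,
        cycle u w v, cycle u v w, ρ.act_comp (v ⇀ u) (v ⇀ w) y, cycle v w u]
      exact LAlgebra.cycle _ _ _
    · exact LAlgebra.cycle _ _ _
  antisymm := by
    rintro ⟨x, u⟩ ⟨y, v⟩ h1 h2
    obtain ⟨a1, b1⟩ := SemidirectProduct.mk.inj h1
    obtain ⟨a2, b2⟩ := SemidirectProduct.mk.inj h2
    simp only at a1 b1 a2 b2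
    rw [b1, b2, ρ.act_one, ρ.act_one] at a1 a2
    rw [LAlgebra.antisymm u v b1 b2, LAlgebra.antisymm x y a1 a2]

end SemidirectProduct

/-! The free monoid `M(X)` on `X` is realised as the lists over `X` (product `++`, unit `[]`). The
operation of `X` extends uniquely to it subject to `ab · c = a · (b · c)`,
`a · bc = ((c · a) · b)(a · c)` and `[] · a = a`. -/
section Words

variable {X : Type u} [LAlgebra X]

/-- A word acting on a letter: `x₁ ⋯ xₙ · y = x₁ · (x₂ · (⋯ (xₙ · y)))`. -/
def wordLetter (a : List X) (y : X) : X := a.foldr op y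

/-- A letter acting on a word: `x · bc = ((c · x) · b)(x · c)` for a letter `b` and a word `c`. -/
def letterWord (x : X) : List X → List X
  | [] => []
  | b :: c => (wordLetter c x ⇀ b) :: letterWord x c

/-- A word acting on a word: `x₁ ⋯ xₙ · w = x₁ · (x₂ · (⋯ (xₙ · w)))`. -/
def wordOp (a w : List X) : List X := a.foldr letterWord w

theorem nil_wordOp (a : List X) : wordOp [] a = a := rfl

theorem cons_wordOp (x : X) (a c : List X) : wordOp (x :: a) c = letterWord x (wordOp a c) := rfl

theorem append_wordOp (a b c : List X) : wordOp (a ++ b) c = wordOp a (wordOp b c) := by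
  simp [wordOp]

theorem append_wordLetter (a b : List X) (y : X) :
    wordLetter (a ++ b) y = wordLetter a (wordLetter b y) := by
  simp [wordLetter]

theorem wordOp_nil (a : List X) : wordOp a [] = [] := by
  induction a with
  | nil => rfl
  | cons x a ih => rw [cons_wordOp, ih]; rfl

theorem wordOp_singleton (a : List X) (y : X) : wordOp a [y] = [wordLetter a y] := by
  induction a with
  | nil => rfl
  | cons x a ih => rw [cons_wordOp, ih]; rfl

theorem letterWord_append (x : X) (b c : List X) :
    letterWord x (b ++ c) = letterWord (wordLetter c x) b ++ letterWord x c := by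
  induction b with
  | nil => rfl
  | cons y b ih => simp [letterWord, ih, append_wordLetter]

theorem wordOp_cons (c : List X) (x : X) (a : List X) :
    wordOp c (x :: a) = wordLetter (wordOp a c) x :: wordOp c a := by
  match c with
  | [] => rw [wordOp_nil]; rfl
  | y :: c =>
    rw [cons_wordOp, wordOp_cons c x a, wordOp_cons a y c]
    rfl
termination_by c.length + a.length

theorem wordOp_append (a b c : List X) :
    wordOp a (b ++ c) = wordOp (wordOp c a) b ++ wordOp a c := by
  induction a with
  | nil => simp [wordOp_nil, nil_wordOp]
  | cons x a ih => rw [cons_wordOp, ih, letterWord_append, cons_wordOp, wordOp_cons, cons_wordOp]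

theorem letterWord_one (a : List X) : letterWord 1 a = a := by
  have h : ∀ c : List X, wordLetter c (1 : X) = 1 := fun c => by
    induction c with
    | nil => rfl
    | cons x c ih => change x ⇀ wordLetter c 1 = 1; rw [ih, op_one]
  induction a with
  | nil => rfl
  | cons x a ih => simp [letterWord, h, one_op, ih]

theorem ones_wordOp (n : ℕ) (c : List X) : wordOp (List.replicate n 1) c = c := by
  induction n with
  | zero => rfl
  | succ n ih => rw [List.replicate_succ, cons_wordOp, ih, letterWord_one]

theorem letterWord_length (x : X) (a : List X) : (letterWord x a).length = a.length := by
  induction a with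
  | nil => rfl
  | cons y a ih => simp [letterWord, ih]

theorem wordOp_ones (a : List X) (n : ℕ) :
    wordOp a (List.replicate n 1) = List.replicate n 1 := by
  have h : ∀ (x : X) (n : ℕ), letterWord x (List.replicate n 1) = List.replicate n 1 :=
    fun x n => by
      induction n with
      | zero => rfl
      | succ n ih => rw [List.replicate_succ, letterWord, ih, op_one]
  induction a with
  | nil => rfl
  | cons x a ih => rw [cons_wordOp, ih, h]

theorem wordOp_self (a : List X) : wordOp a a = List.replicate a.length 1 := by
  have h : ∀ (n : ℕ) (x : X), wordLetter (List.replicate n 1) x = x := fun n x => by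
    have := ones_wordOp n [x]
    rw [wordOp_singleton] at this
    exact (List.cons.inj this).1
  induction a with
  | nil => rfl
  | cons x a ih =>
    rw [wordOp_cons, cons_wordOp, wordOp_cons, ih, h]
    have h1 := wordOp_ones [x] a.length
    rw [cons_wordOp, nil_wordOp] at h1
    change (x ⇀ wordLetter (List.replicate a.length 1) x) :: letterWord x _ = _
    rw [h, op_self, h1]
    rfl

theorem wordOp_cycle (a b c : List X) :
    wordOp (wordOp a b) (wordOp a c) = wordOp (wordOp b a) (wordOp b c) := by
  have h1 : ∀ (x y : X) (c : List X),
      wordLetter (letterWord x c) (x ⇀ y) = wordLetter c x ⇀ wordLetter c y := by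
    intro x y c
    induction c with
    | nil => rfl
    | cons d c ih =>
      change (wordLetter c x ⇀ d) ⇀ wordLetter (letterWord x c) (x ⇀ y) =
        (d ⇀ wordLetter c x) ⇀ (d ⇀ wordLetter c y)
      rw [ih, cycle]
  have h2 : ∀ (x y : X) (c : List X),
      letterWord (x ⇀ y) (letterWord x c) = letterWord (y ⇀ x) (letterWord y c) := by
    intro x y c
    induction c with
    | nil => rfl
    | cons d c ih => simp only [letterWord, h1, ih, cycle (wordLetter c x)]
  have h3 : ∀ (x : X) (a c : List X),
      wordOp (letterWord x a) (letterWord x c) =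
        letterWord (wordLetter a x) (wordOp a c) := by
    intro x a c
    induction a with
    | nil => rfl
    | cons y a ih =>
      rw [letterWord, cons_wordOp, ih, h2]
      rfl
  induction a with
  | nil => rw [wordOp_nil]; rfl
  | cons x a ih => rw [cons_wordOp, cons_wordOp, h3, ih, wordOp_cons, cons_wordOp]

/-- `a ≈ b` iff `(c · a) · d = (c · b) · d` for all words `c`, `d`. -/
instance wordSetoid (X : Type u) [LAlgebra X] : Setoid (List X) where
  r a b := ∀ c d : List X, wordOp (wordOp c a) d = wordOp (wordOp c b) d
  iseqv := ⟨fun _ _ _ => rfl, fun h c d => (h c d).symm, fun h k c d => (h c d).trans (k c d)⟩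

theorem wordOp_congr {a a' b b' : List X} (ha : a ≈ a') (hb : b ≈ b') :
    wordOp a b ≈ wordOp a' b' := fun c d => by
  have h : wordOp a b = wordOp a' b := ha [] b
  rw [h, ← append_wordOp, ← append_wordOp]
  exact hb _ d

end Words

/-- The self-similar closure `S(X) = M(X)/≈`. -/
def SelfSimilarClosure (X : Type u) [LAlgebra X] : Type u := Quotient (wordSetoid X)

namespace SelfSimilarClosure

variable {X : Type u} [LAlgebra X]

instance : LAlgebra (SelfSimilarClosure X) where
  one := Quotient.mk _ []
  op := Quotient.map₂ wordOp fun _ _ ha _ _ hb => wordOp_congr ha hb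
  one_op := by
    rintro ⟨a⟩
    rfl
  op_one := by
    rintro ⟨a⟩
    exact congrArg (Quotient.mk _) (wordOp_nil a)
  op_self := by
    rintro ⟨a⟩
    refine Quotient.sound fun c d => ?_
    rw [wordOp_self, wordOp_ones, ones_wordOp, wordOp_nil, nil_wordOp]
  cycle := by
    rintro ⟨a⟩ ⟨b⟩ ⟨c⟩
    exact congrArg (Quotient.mk _) (wordOp_cycle a b c)
  antisymm := by
    rintro ⟨a⟩ ⟨b⟩ h1 h2
    have h1 : wordOp a b ≈ [] := Quotient.exact h1
    have h2 : wordOp b a ≈ [] := Quotient.exact h2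
    refine Quotient.sound fun c d => ?_
    have k1 := h1 (wordOp a c) (wordOp (wordOp c a) d)
    have k2 := h2 (wordOp b c) (wordOp (wordOp c b) d)
    rw [wordOp_nil, nil_wordOp, wordOp_cycle] at k1 k2
    rw [← k1, ← k2, wordOp_cycle]

/-- The canonical map `X → S(X)`. -/
def of (x : X) : SelfSimilarClosure X := Quotient.mk _ [x]

/-- The class of a word. -/
def mk (a : List X) : SelfSimilarClosure X := Quotient.mk _ a

theorem mk_op (a b : List X) : mk a ⇀ mk b = mk (wordOp a b) := rfl

theorem mk_ones (n : ℕ) : mk (List.replicate n (1 : X)) = 1 :=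
  Quotient.sound fun c d => by rw [wordOp_ones, ones_wordOp, wordOp_nil, nil_wordOp]

theorem mk_append_congr {a a' b b' : List X} (ha : mk a = mk a') (hb : mk b = mk b') :
    mk (a ++ b) = mk (a' ++ b') := by
  have ha : a ≈ a' := Quotient.exact ha
  have hb : b ≈ b' := Quotient.exact hb
  refine Quotient.sound fun c d => ?_
  have h : wordOp b c = wordOp b' c := hb [] c
  rw [wordOp_append, wordOp_append, append_wordOp, append_wordOp, h, ha, hb]

theorem mk_append_le (a b : List X) : mk (a ++ b) ⇀ mk b = 1 := by
  rw [mk_op, append_wordOp, wordOp_self, wordOp_ones, mk_ones]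

theorem op_mk_append (a b : List X) : mk b ⇀ mk (a ++ b) = mk a := by
  rw [mk_op, wordOp_append, wordOp_self, ones_wordOp]
  exact (mk_append_congr rfl (mk_ones _)).trans (congrArg mk (List.append_nil a))

theorem mk_append_comm (a b : List X) :
    mk (wordOp a b ++ a) = mk (wordOp b a ++ b) := by
  have h : ∀ a b : List X, mk (wordOp a b ++ a) ⇀ mk (wordOp b a ++ b) = 1 := fun a b => by
    rw [mk_op, append_wordOp, wordOp_append, wordOp_append, wordOp_self (wordOp b a),
      wordOp_ones, wordOp_self, ← List.replicate_add, mk_ones]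
  exact antisymm _ _ (h a b) (h b a)

theorem isSelfSimilar (X : Type u) [LAlgebra X] : IsSelfSimilar (SelfSimilarClosure X) := by
  rintro ⟨a⟩
  refine ⟨fun _ _ => Set.mem_univ _, ?_, ?_⟩
  · have key : ∀ b : List X, mk b ⇀ mk a = 1 → mk b = mk (wordOp a b ++ a) := fun b hb => by
      rw [mk_append_comm]
      exact mk_append_congr (a := []) hb.symm rfl
    rintro ⟨b⟩ hb ⟨c⟩ hc h
    change mk b = mk c
    rw [key b hb, key c hc]
    exact mk_append_congr h rfl
  · rintro ⟨b⟩ -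
    exact ⟨mk (b ++ a), mk_append_le b a, op_mk_append b a⟩

/-- The product of `S(X)` is induced by that of the free monoid. -/
theorem mul_mk (a b : List X) : (isSelfSimilar X).mul (mk a) (mk b) = mk (a ++ b) :=
  ((isSelfSimilar X).eq_mul (mk_append_le a b) (op_mk_append a b)).symm

/-- `S(X)` is a self-similar L-algebra with `X` as an L-subalgebra generating it as a monoid. -/
theorem isSelfSimilarClosure_of (X : Type u) [LAlgebra X] :
    IsSelfSimilarClosure (of : X → SelfSimilarClosure X) where
  injective x y h := by
    have h : [x] ≈ [y] := Quotient.exact h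
    have h1 := h [] [y]
    have h2 := h [] [x]
    simp only [wordOp_singleton] at h1 h2
    have h1 : x ⇀ y = y ⇀ y := (List.cons.inj h1).1
    have h2 : x ⇀ x = y ⇀ x := (List.cons.inj h2).1
    exact antisymm x y (h1.trans (op_self y)) (h2.symm.trans (op_self x))
  map_one := mk_ones 1
  map_op _ _ := rfl
  selfSimilar := isSelfSimilar X
  generates := by
    let _ := (isSelfSimilar X).monoid
    refine (Submonoid.eq_top_iff' _).2 ?_
    rintro ⟨a⟩
    induction a with
    | nil => exact Submonoid.one_mem _
    | cons x a ih =>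
      have h : of x * mk a = mk (x :: a) := mul_mk [x] a
      change mk (x :: a) ∈ _
      rw [← h]
      exact Submonoid.mul_mem _ (Submonoid.subset_closure ⟨x, rfl⟩) ih

end SelfSimilarClosure

/-- `σ`, an operation of `S(Y)` on `S(X)`, extends the operation `ρ` of `Y` on `X`. -/
def Operation.Extends {X : Type u} {Y : Type v} [LAlgebra X] [LAlgebra Y]
    (σ : Operation (SelfSimilarClosure Y) (SelfSimilarClosure X)) (ρ : Operation Y X) : Prop :=
  ∀ (u : Y) (x : X), (σ.act (SelfSimilarClosure.of u)).toFun (SelfSimilarClosure.of x) =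
    SelfSimilarClosure.of ((ρ.act u).toFun x)

end LAlgebra

/-! In a self-similar L-algebra a product equals 1 only if both factors do (`mul_eq_one`). Hence a
word represents 1 in `S(X)` exactly when all its letters are 1, and by antisymmetry `a` and `b` are
congruent exactly when `a · b` and `b · a` consist of ones (`mk_eq_mk_iff`). This finite test
replaces the quantifiers over `c` and `d` in `≈`.

It carries the whole proof. Evaluation of words in a self-similar L-algebra factors through `S(X)`
(`lift`) and is bijective for every self-similar closure. Likewise, the composite action of a word
over `Y` depends only on its class, because the cocycle law passes from letters to words
(`wordAct_wordOp`). Uniqueness holds since morphisms into self-similar L-algebras are determined on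
generators and actions turn products into composites (`act_mul`).

In a semidirect product, `(x, u)(y, v) = (x ρ_u(y), uv)`. This formula yields self-similarity from
that of the factors, and the factorisation `(x, u) = (x, 1)(1, u)` yields generation. -/

namespace LAlgebra

/-! ### Arithmetic of products in self-similar L-algebras -/

namespace IsSelfSimilar

variable {X : Type u} [LAlgebra X]

/-- The rule imposed on words is automatic here: the cycle law gives both defining conditions of the
product. -/
theorem op_mul (h : IsSelfSimilar X) (a b c : X) :
    a ⇀ h.mul b c = h.mul ((c ⇀ a) ⇀ b) (a ⇀ c) := by
  apply h.eq_mul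
  · rw [cycle, h.mul_op_right, op_one]
  · rw [cycle, h.op_mul_self]

theorem mul_eq_one (h : IsSelfSimilar X) {a b : X} (hab : h.mul a b = 1) : a = 1 ∧ b = 1 := by
  have hb := h.mul_op_right a b
  rw [hab, one_op] at hb
  have ha := h.op_mul_self a b
  rw [hab, op_one] at ha
  exact ⟨ha.symm, hb⟩

theorem one_mul (h : IsSelfSimilar X) (a : X) : h.mul 1 a = a :=
  (h.eq_mul (op_self a) (op_self a)).symm

theorem mul_one (h : IsSelfSimilar X) (a : X) : h.mul a 1 = a :=
  (h.eq_mul (op_one a) (one_op a)).symm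

theorem mul_assoc (h : IsSelfSimilar X) (a b c : X) :
    h.mul (h.mul a b) c = h.mul a (h.mul b c) :=
  h.monoid.mul_assoc a b c

/-- A map between self-similar L-algebras that preserves the operation preserves products. -/
theorem map_mul {Y : Type v} [LAlgebra Y] (hX : IsSelfSimilar X) (hY : IsSelfSimilar Y)
    {f : X → Y} (hf : ∀ x y, f (x ⇀ y) = f x ⇀ f y) (x y : X) :
    f (hX.mul x y) = hY.mul (f x) (f y) := by
  apply hY.eq_mul
  · rw [← hf, hX.mul_op_right, ← op_self (1 : X), hf, op_self]
  · rw [← hf, hX.op_mul_self]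

end IsSelfSimilar

/-- Maps on `S(X)` that preserve the operation are determined by their values on `X`. -/
theorem SelfSimilarClosure.map_ext {X : Type u} [LAlgebra X] {S : Type v} [LAlgebra S]
    (hS : IsSelfSimilar S) {f g : SelfSimilarClosure X → S}
    (hf : ∀ x y, f (x ⇀ y) = f x ⇀ f y) (hg : ∀ x y, g (x ⇀ y) = g x ⇀ g y)
    (h : ∀ x : X, f (of x) = g (of x)) : f = g := by
  funext s
  obtain ⟨a⟩ := s
  change f (mk a) = g (mk a)
  induction a with
  | nil =>
    change f 1 = g 1
    rw [← op_self (1 : SelfSimilarClosure X), hf, hg, op_self, op_self]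
  | cons x a ih =>
    have hx : mk (x :: a) = (isSelfSimilar X).mul (of x) (mk a) := (mul_mk [x] a).symm
    rw [hx, (isSelfSimilar X).map_mul hS hf, (isSelfSimilar X).map_mul hS hg, h, ih]

/-! ### Evaluation of words in a self-similar L-algebra -/

section WordProd

variable {X : Type u} {S : Type v} [LAlgebra S]

/-- The product in `S` of the images of the letters of a word. -/
noncomputable def wordProd (hS : IsSelfSimilar S) (f : X → S) (a : List X) : S :=
  a.foldr (fun x s => hS.mul (f x) s) 1

variable {hS : IsSelfSimilar S} {f : X → S}

theorem wordProd_cons (x : X) (a : List X) :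
    wordProd hS f (x :: a) = hS.mul (f x) (wordProd hS f a) := rfl

theorem wordProd_append (a b : List X) :
    wordProd hS f (a ++ b) = hS.mul (wordProd hS f a) (wordProd hS f b) := by
  induction a with
  | nil => exact (hS.one_mul _).symm
  | cons x a ih => rw [List.cons_append, wordProd_cons, wordProd_cons, ih, hS.mul_assoc]

variable [LAlgebra X]

theorem map_wordLetter (hf : ∀ x y, f (x ⇀ y) = f x ⇀ f y) (a : List X) (y : X) :
    f (wordLetter a y) = wordProd hS f a ⇀ f y := by
  induction a with
  | nil => exact (one_op _).symm
  | cons x a ih =>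
    change f (x ⇀ wordLetter a y) = _
    rw [hf, ih, wordProd_cons, hS.mul_op]

/-- The recursion defining `letterWord` is `op_mul` read in `S`, so evaluation respects it. -/
theorem wordProd_letterWord (hf : ∀ x y, f (x ⇀ y) = f x ⇀ f y) (x : X) (a : List X) :
    wordProd hS f (letterWord x a) = f x ⇀ wordProd hS f a := by
  induction a with
  | nil => exact (op_one _).symm
  | cons y a ih =>
    rw [letterWord, wordProd_cons, ih, hf, map_wordLetter (hS := hS) hf, wordProd_cons,
      hS.op_mul]

theorem wordProd_wordOp (hf : ∀ x y, f (x ⇀ y) = f x ⇀ f y) (a b : List X) :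
    wordProd hS f (wordOp a b) = wordProd hS f a ⇀ wordProd hS f b := by
  induction a with
  | nil => exact (one_op _).symm
  | cons x a ih => rw [cons_wordOp, wordProd_letterWord hf, ih, wordProd_cons, hS.mul_op]

theorem wordProd_eq_one (hS : IsSelfSimilar S) (h1 : f 1 = 1) {a : List X}
    (ha : ∀ x ∈ a, x = 1) : wordProd hS f a = 1 := by
  induction a with
  | nil => rfl
  | cons x a ih =>
    rw [wordProd_cons, ha x List.mem_cons_self, h1,
      ih fun y hy => ha y (List.mem_cons_of_mem _ hy), hS.one_mul]

theorem eq_one_of_wordProd_eq_one (hf : ∀ x, f x = 1 → x = 1) {a : List X}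
    (ha : wordProd hS f a = 1) : ∀ x ∈ a, x = 1 := by
  induction a with
  | nil => simp
  | cons x a ih =>
    obtain ⟨hx, ha⟩ := hS.mul_eq_one ha
    exact List.forall_mem_cons.2 ⟨hf x hx, ih ha⟩

theorem SelfSimilarClosure.wordProd_of (a : List X) :
    wordProd (isSelfSimilar X) of a = mk a := by
  induction a with
  | nil => rfl
  | cons x a ih => rw [wordProd_cons, ih]; exact mul_mk [x] a

end WordProd

/-! ### Universal property and uniqueness of the self-similar closure -/

namespace SelfSimilarClosure

variable {X : Type u} [LAlgebra X]

/-- A word represents `1` in `S(X)` iff all its letters are `1`. -/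
theorem mk_eq_one_iff {a : List X} : mk a = 1 ↔ ∀ x ∈ a, x = 1 := by
  have hc := isSelfSimilarClosure_of X
  rw [← wordProd_of]
  exact ⟨eq_one_of_wordProd_eq_one fun x hx => hc.injective (hx.trans hc.map_one.symm),
    wordProd_eq_one _ hc.map_one⟩

theorem mk_eq_mk_iff {a b : List X} :
    mk a = mk b ↔ (∀ x ∈ wordOp a b, x = 1) ∧ ∀ x ∈ wordOp b a, x = 1 := by
  rw [← mk_eq_one_iff, ← mk_eq_one_iff, ← mk_op, ← mk_op]
  refine ⟨fun h => ?_, fun h => antisymm _ _ h.1 h.2⟩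
  rw [h, op_self]
  exact ⟨rfl, rfl⟩

/-- A morphism from `X` to a self-similar L-algebra extends to `S(X)`. -/
noncomputable def lift {S : Type v} [LAlgebra S] (hS : IsSelfSimilar S) (f : Hom X S) :
    Hom (SelfSimilarClosure X) S where
  toFun := Quotient.lift (wordProd hS f.toFun) fun a b hab => by
    obtain ⟨h1, h2⟩ := mk_eq_mk_iff.1 (Quotient.sound hab : mk a = mk b)
    apply antisymm <;> rw [← wordProd_wordOp f.map_op]
    · exact wordProd_eq_one hS f.map_one h1
    · exact wordProd_eq_one hS f.map_one h2
  map_op := by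
    rintro ⟨a⟩ ⟨b⟩
    exact wordProd_wordOp f.map_op a b

theorem lift_of {S : Type v} [LAlgebra S] (hS : IsSelfSimilar S) (f : Hom X S) (x : X) :
    (lift hS f).toFun (of x) = f.toFun x :=
  hS.mul_one _

end SelfSimilarClosure

/-- The canonical map from `S(X)` to any self-similar closure of `X` is bijective. -/
theorem IsSelfSimilarClosure.bijective_lift {X : Type u} {S : Type v} [LAlgebra X] [LAlgebra S]
    {f : X → S} (hf : IsSelfSimilarClosure f) :
    Function.Bijective
      (SelfSimilarClosure.lift hf.selfSimilar ⟨f, hf.map_op⟩).toFun := by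
  have hinj : ∀ x, f x = 1 → x = 1 := fun x hx => hf.injective (hx.trans hf.map_one.symm)
  constructor
  -- Equal values make `a · b` and `b · a` evaluate to 1; since only 1 is sent to 1, all their
  -- letters are 1.
  · rintro ⟨a⟩ ⟨b⟩ hab
    change wordProd hf.selfSimilar f a = wordProd hf.selfSimilar f b at hab
    refine SelfSimilarClosure.mk_eq_mk_iff.2 ⟨?_, ?_⟩ <;>
      refine eq_one_of_wordProd_eq_one (hS := hf.selfSimilar) hinj ?_ <;>
      rw [wordProd_wordOp hf.map_op, hab, op_self]
  · intro s
    let _ := hf.selfSimilar.monoid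
    have hs : s ∈ Submonoid.closure (Set.range f) := hf.generates ▸ Submonoid.mem_top s
    suffices h : ∃ a, wordProd hf.selfSimilar f a = s by
      obtain ⟨a, ha⟩ := h
      exact ⟨SelfSimilarClosure.mk a, ha⟩
    induction hs using Submonoid.closure_induction with
    | mem s hs =>
      obtain ⟨x, rfl⟩ := hs
      exact ⟨[x], hf.selfSimilar.mul_one _⟩
    | one => exact ⟨[], rfl⟩
    | mul s t _ _ hs ht =>
      obtain ⟨a, rfl⟩ := hs
      obtain ⟨b, rfl⟩ := ht
      exact ⟨a ++ b, wordProd_append a b⟩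

/-- A self-similar closure is uniquely isomorphic to `S(X)` under `X`. -/
theorem IsSelfSimilarClosure.existsUnique_iso {X : Type u} {S : Type v} [LAlgebra X]
    [LAlgebra S] {f : X → S} (hf : IsSelfSimilarClosure f) :
    ∃! e : Iso (SelfSimilarClosure X) S,
      ∀ x, e.toEquiv (SelfSimilarClosure.of x) = f x := by
  refine ⟨⟨Equiv.ofBijective _ hf.bijective_lift, (SelfSimilarClosure.lift _ _).map_op⟩,
    SelfSimilarClosure.lift_of _ _, ?_⟩
  rintro ⟨e, he⟩ h
  congr 1
  apply Equiv.coe_fn_injective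
  exact SelfSimilarClosure.map_ext hf.selfSimilar he (SelfSimilarClosure.lift _ _).map_op
    fun x => (h x).trans (SelfSimilarClosure.lift_of hf.selfSimilar ⟨f, hf.map_op⟩ x).symm

/-! ### Extension of endomorphisms and operations -/

namespace Hom

variable {X : Type u} [LAlgebra X]

/-- The endomorphism of `S(X)` induced by an endomorphism of `X`. -/
noncomputable def closure (f : Hom X X) : Hom (SelfSimilarClosure X) (SelfSimilarClosure X) :=
  SelfSimilarClosure.lift (SelfSimilarClosure.isSelfSimilar X)
    ⟨fun x => SelfSimilarClosure.of (f.toFun x), fun x y => by rw [f.map_op]; rfl⟩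

theorem closure_of (f : Hom X X) (x : X) :
    f.closure.toFun (SelfSimilarClosure.of x) = SelfSimilarClosure.of (f.toFun x) :=
  SelfSimilarClosure.lift_of _ _ x

end Hom

namespace Operation

variable {X : Type u} {Y : Type v} [LAlgebra X] [LAlgebra Y] (ρ : Operation Y X)

/-- The action of a word over `Y`, the composite of the actions of its letters. -/
def wordAct : List Y → Hom X X
  | [] => ⟨id, fun _ _ => rfl⟩
  | u :: a => ⟨fun x => (ρ.act u).toFun ((wordAct a).toFun x), fun x y => by
      rw [Hom.map_op, Hom.map_op]⟩

theorem wordAct_cons (u : Y) (a : List Y) (x : X) :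
    (ρ.wordAct (u :: a)).toFun x = (ρ.act u).toFun ((ρ.wordAct a).toFun x) := rfl

/-- Each letter `v` of the word contributes one use of the cocycle law, applied to `v` and to what
the letters after it have made of `u`. -/
theorem wordAct_letterWord (u : Y) (a : List Y) (x : X) :
    (ρ.wordAct (letterWord u a)).toFun ((ρ.act u).toFun x) =
      (ρ.act (wordLetter a u)).toFun ((ρ.wordAct a).toFun x) := by
  induction a with
  | nil => rfl
  | cons v a ih =>
    rw [letterWord, wordAct_cons, ih, ρ.act_comp]
    rfl

theorem wordAct_wordOp (a b : List Y) (x : X) :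
    (ρ.wordAct (wordOp a b)).toFun ((ρ.wordAct a).toFun x) =
      (ρ.wordAct (wordOp b a)).toFun ((ρ.wordAct b).toFun x) := by
  induction a with
  | nil => rw [wordOp_nil]; rfl
  | cons u a ih =>
    rw [cons_wordOp, wordAct_cons, wordAct_letterWord, ih, wordOp_cons, wordAct_cons]

theorem wordAct_eq_self {a : List Y} (ha : ∀ u ∈ a, u = 1) (x : X) :
    (ρ.wordAct a).toFun x = x := by
  induction a with
  | nil => rfl
  | cons u a ih =>
    rw [wordAct_cons, ha u List.mem_cons_self, ρ.act_one,
      ih fun v hv => ha v (List.mem_cons_of_mem _ hv)]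

/-- An operation of `Y` extends to an operation of `S(Y)` on the same L-algebra. -/
def closureLeft : Operation (SelfSimilarClosure Y) X where
  act := Quotient.lift ρ.wordAct fun a b hab => by
    obtain ⟨h1, h2⟩ := SelfSimilarClosure.mk_eq_mk_iff.1
      (Quotient.sound hab : SelfSimilarClosure.mk a = SelfSimilarClosure.mk b)
    ext x
    -- Both `a · b` and `b · a` act trivially, so the cocycle law for words reduces to equality of
    -- the actions of `a` and `b`.
    rw [← ρ.wordAct_eq_self h1 ((ρ.wordAct a).toFun x), wordAct_wordOp,
      ρ.wordAct_eq_self h2]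
  act_one _ := rfl
  act_comp := by
    rintro ⟨a⟩ ⟨b⟩ x
    exact ρ.wordAct_wordOp a b x

/-- An operation on `X` extends to an operation on `S(X)` of the same L-algebra. -/
noncomputable def closureRight : Operation Y (SelfSimilarClosure X) where
  act u := (ρ.act u).closure
  act_one := congrFun <| SelfSimilarClosure.map_ext (SelfSimilarClosure.isSelfSimilar X)
    (Hom.map_op _) (g := id) (fun _ _ => rfl) fun x => by rw [Hom.closure_of, ρ.act_one]; rfl
  act_comp u v := congrFun <| SelfSimilarClosure.map_ext (SelfSimilarClosure.isSelfSimilar X)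
    (f := fun s => (ρ.act (u ⇀ v)).closure.toFun ((ρ.act u).closure.toFun s))
    (g := fun s => (ρ.act (v ⇀ u)).closure.toFun ((ρ.act v).closure.toFun s))
    (fun x y => by rw [Hom.map_op, Hom.map_op]) (fun x y => by rw [Hom.map_op, Hom.map_op])
    fun x => by simp only [Hom.closure_of, ρ.act_comp u v]

/-- The action of a product in a self-similar L-algebra is the composite of the actions. -/
theorem act_mul (hY : IsSelfSimilar Y) (u v : Y) (x : X) :
    (ρ.act (hY.mul u v)).toFun x = (ρ.act u).toFun ((ρ.act v).toFun x) := by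
  -- Here `v · uv = u`, while `uv · v = 1` acts trivially.
  have h := ρ.act_comp v (hY.mul u v) x
  rw [hY.op_mul_self, hY.mul_op_right, ρ.act_one] at h
  exact h.symm

/-- Every operation of `Y` on `X` extends uniquely to an operation of `S(Y)` on `S(X)`. -/
theorem existsUnique_extends :
    ∃! σ : Operation (SelfSimilarClosure Y) (SelfSimilarClosure X), σ.Extends ρ := by
  have hX := SelfSimilarClosure.isSelfSimilar X
  have hY := SelfSimilarClosure.isSelfSimilar Y
  -- The two extensions are independent: first from `X` to `S(X)`, then from `Y` to `S(Y)`.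
  refine ⟨ρ.closureRight.closureLeft, fun u x => Hom.closure_of (ρ.act u) x, ?_⟩
  suffices h : ∀ σ τ : Operation (SelfSimilarClosure Y) (SelfSimilarClosure X),
      σ.Extends ρ → τ.Extends ρ → σ = τ from
    fun σ hσ => h σ _ hσ fun u x => Hom.closure_of (ρ.act u) x
  intro σ τ hσ hτ
  ext u s
  obtain ⟨a⟩ := u
  change (σ.act (SelfSimilarClosure.mk a)).toFun s = (τ.act (SelfSimilarClosure.mk a)).toFun s
  induction a with
  | nil => exact (σ.act_one s).trans (τ.act_one s).symm
  | cons u a ih =>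
    have hu : SelfSimilarClosure.mk (u :: a) =
        hY.mul (SelfSimilarClosure.of u) (SelfSimilarClosure.mk a) :=
      (SelfSimilarClosure.mul_mk [u] a).symm
    have hact := SelfSimilarClosure.map_ext hX (σ.act (SelfSimilarClosure.of u)).map_op
      (τ.act (SelfSimilarClosure.of u)).map_op fun x => (hσ u x).trans (hτ u x).symm
    rw [hu, act_mul, act_mul, ih, hact]

end Operation

/-! ### Self-similarity and closure of semidirect products -/

namespace SemidirectProduct

variable {X : Type u} {Y : Type v} [LAlgebra X] [LAlgebra Y] {ρ : Operation Y X}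

theorem one_def : (1 : SemidirectProduct ρ) = ⟨1, 1⟩ := rfl

theorem op_def (p q : SemidirectProduct ρ) :
    p ⇀ q = ⟨(ρ.act (p.snd ⇀ q.snd)).toFun p.fst ⇀ (ρ.act (q.snd ⇀ p.snd)).toFun q.fst,
      p.snd ⇀ q.snd⟩ := rfl

theorem mem_downset_iff {p q : SemidirectProduct ρ} :
    q ∈ downset p ↔ q.snd ⇀ p.snd = 1 ∧ q.fst ⇀ (ρ.act (p.snd ⇀ q.snd)).toFun p.fst = 1 := by
  rw [downset, Set.mem_ofPred_eq, op_def, one_def, SemidirectProduct.mk.injEq]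
  constructor
  · rintro ⟨h1, h2⟩
    rw [h2, ρ.act_one] at h1
    exact ⟨h2, h1⟩
  · rintro ⟨h1, h2⟩
    rw [h1, ρ.act_one]
    exact ⟨h2, rfl⟩

theorem op_of_le {p q : SemidirectProduct ρ} (h : q.snd ⇀ p.snd = 1) :
    p ⇀ q = ⟨(ρ.act (p.snd ⇀ q.snd)).toFun p.fst ⇀ q.fst, p.snd ⇀ q.snd⟩ := by
  rw [op_def, h, ρ.act_one]

theorem isSelfSimilar (hX : IsSelfSimilar X) (hY : IsSelfSimilar Y) :
    IsSelfSimilar (SemidirectProduct ρ) := by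
  intro p
  refine ⟨fun _ _ => Set.mem_univ _, ?_, ?_⟩
  · intro q hq r hr h
    rw [mem_downset_iff] at hq hr
    change p ⇀ q = p ⇀ r at h
    rw [op_of_le hq.1, op_of_le hr.1, SemidirectProduct.mk.injEq] at h
    obtain ⟨h1, h2⟩ := h
    -- After this rewriting both first components lie in the same downset of `X`.
    rw [h2] at h1 hq
    ext
    · exact (hX _).injOn hq.2 hr.2 h1
    · exact (hY _).injOn hq.1 hr.1 h2
  · rintro ⟨z, w⟩ -
    have hw : (hY.mul w p.snd) ⇀ p.snd = 1 := hY.mul_op_right _ _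
    -- This is the product `(z, w)(x, u)` with `p = (x, u)`.
    refine ⟨⟨hX.mul z ((ρ.act w).toFun p.fst), hY.mul w p.snd⟩, mem_downset_iff.2 ⟨hw, ?_⟩, ?_⟩
    · simp only [hY.op_mul_self, hX.mul_op_right]
    · change p ⇀ (_ : SemidirectProduct ρ) = _
      rw [op_of_le hw]
      simp only [hY.op_mul_self, hX.op_mul_self]

theorem mul_def (h : IsSelfSimilar (SemidirectProduct ρ)) (hX : IsSelfSimilar X)
    (hY : IsSelfSimilar Y) (p q : SemidirectProduct ρ) :
    h.mul p q = ⟨hX.mul p.fst ((ρ.act p.snd).toFun q.fst), hY.mul p.snd q.snd⟩ := by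
  symm
  have hw : (hY.mul p.snd q.snd) ⇀ q.snd = 1 := hY.mul_op_right _ _
  apply h.eq_mul
  · refine mem_downset_iff.2 ⟨hw, ?_⟩
    simp only [hY.op_mul_self, hX.mul_op_right]
  · rw [op_of_le hw]
    simp only [hY.op_mul_self, hX.op_mul_self]

/-- For the forward direction, restrict to the slices `(x, 1)` and `(1, u)`, on which the operation
is that of `X` and of `Y`. -/
theorem isSelfSimilar_iff :
    IsSelfSimilar (SemidirectProduct ρ) ↔ IsSelfSimilar X ∧ IsSelfSimilar Y := by
  refine ⟨fun h => ⟨fun x => ?_, fun u => ?_⟩, fun h => isSelfSimilar h.1 h.2⟩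
  · have mem : ∀ y, y ∈ downset x → (⟨y, 1⟩ : SemidirectProduct ρ) ∈ downset ⟨x, 1⟩ :=
      fun y hy => mem_downset_iff.2 ⟨op_self _, by rw [op_self, ρ.act_one]; exact hy⟩
    have hop : ∀ y, (⟨x, 1⟩ ⇀ ⟨y, 1⟩ : SemidirectProduct ρ) = ⟨x ⇀ y, 1⟩ := fun y => by
      rw [op_of_le (op_self (1 : Y))]; simp only [op_self, ρ.act_one]
    refine ⟨fun _ _ => Set.mem_univ _, fun y hy z hz hyz => ?_, fun z _ => ?_⟩
    · have := (h ⟨x, 1⟩).injOn (mem y hy) (mem z hz) ((hop y).trans <| by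
        change x ⇀ y = x ⇀ z at hyz
        rw [hyz]; exact (hop z).symm)
      exact congrArg fst this
    · obtain ⟨⟨y, v⟩, hq, hq'⟩ := (h ⟨x, 1⟩).surjOn (Set.mem_univ ⟨z, 1⟩)
      change (_ ⇀ _) = _ at hq'
      rw [mem_downset_iff] at hq
      rw [op_of_le hq.1, SemidirectProduct.mk.injEq] at hq'
      -- The second component of the preimage satisfies `1 · v = 1`, so the twist by the action
      -- disappears.
      simp only [hq'.2, ρ.act_one] at hq hq'
      exact ⟨y, hq.2, hq'.1⟩
  · have mem : ∀ v, v ∈ downset u → (⟨1, v⟩ : SemidirectProduct ρ) ∈ downset ⟨1, u⟩ :=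
      fun v hv => mem_downset_iff.2 ⟨hv, by rw [Hom.map_one, op_self]⟩
    have hop : ∀ v, (⟨1, u⟩ ⇀ ⟨1, v⟩ : SemidirectProduct ρ) = ⟨1, u ⇀ v⟩ := fun v => by
      rw [op_def]; simp only [Hom.map_one, op_one]
    refine ⟨fun _ _ => Set.mem_univ _, fun v hv w hw hvw => ?_, fun w _ => ?_⟩
    · have := (h ⟨1, u⟩).injOn (mem v hv) (mem w hw) ((hop v).trans <| by
        change u ⇀ v = u ⇀ w at hvw
        rw [hvw]; exact (hop w).symm)
      exact congrArg snd this
    · obtain ⟨q, hq, hq'⟩ := (h ⟨1, u⟩).surjOn (Set.mem_univ ⟨1, w⟩)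
      exact ⟨q.snd, (mem_downset_iff.1 hq).1, congrArg snd hq'⟩

/-- `S(X) ⋊ S(Y)` is a self-similar closure of `X ⋊ Y`. -/
theorem isSelfSimilarClosure
    {σ : Operation (SelfSimilarClosure Y) (SelfSimilarClosure X)} (hσ : σ.Extends ρ) :
    IsSelfSimilarClosure (fun p : SemidirectProduct ρ =>
      (⟨SelfSimilarClosure.of p.fst, SelfSimilarClosure.of p.snd⟩ : SemidirectProduct σ)) := by
  have hX := SelfSimilarClosure.isSelfSimilar X
  have hY := SelfSimilarClosure.isSelfSimilar Y
  have cX := SelfSimilarClosure.isSelfSimilarClosure_of X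
  have cY := SelfSimilarClosure.isSelfSimilarClosure_of Y
  have hS : IsSelfSimilar (SemidirectProduct σ) := isSelfSimilar hX hY
  refine ⟨?_, ?_, ?_, hS, ?_⟩
  · rintro p q h
    rw [SemidirectProduct.mk.injEq] at h
    exact SemidirectProduct.ext (cX.injective h.1) (cY.injective h.2)
  · change SemidirectProduct.mk (SelfSimilarClosure.of 1) (SelfSimilarClosure.of 1) = _
    rw [cX.map_one, cY.map_one, one_def]
  · intro p q
    simp only [op_def, cX.map_op, cY.map_op, ← hσ _ _]
  · let _ := hS.monoid
    set f := fun p : SemidirectProduct ρ =>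
      (⟨SelfSimilarClosure.of p.fst, SelfSimilarClosure.of p.snd⟩ : SemidirectProduct σ)
    have hf : ∀ p, f p ∈ Submonoid.closure (Set.range f) :=
      fun p => Submonoid.subset_closure ⟨p, rfl⟩
    have hmul : ∀ p q : SemidirectProduct σ, p * q =
        ⟨hX.mul p.fst ((σ.act p.snd).toFun q.fst), hY.mul p.snd q.snd⟩ := mul_def hS hX hY
    have mem_left : ∀ a : List X, (⟨SelfSimilarClosure.mk a, 1⟩ : SemidirectProduct σ) ∈
        Submonoid.closure (Set.range f) := by
      intro a
      induction a with
      | nil => exact Submonoid.one_mem _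
      | cons x a ih =>
        have h := Submonoid.mul_mem _ (hf ⟨x, 1⟩) ih
        simp only [hmul, f, cY.map_one, σ.act_one, hY.mul_one] at h
        rwa [show SelfSimilarClosure.mk (x :: a) = hX.mul (SelfSimilarClosure.of x)
          (SelfSimilarClosure.mk a) from (SelfSimilarClosure.mul_mk [x] a).symm]
    have mem_right : ∀ b : List Y, (⟨1, SelfSimilarClosure.mk b⟩ : SemidirectProduct σ) ∈
        Submonoid.closure (Set.range f) := by
      intro b
      induction b with
      | nil => exact Submonoid.one_mem _
      | cons u b ih =>
        have h := Submonoid.mul_mem _ (hf ⟨1, u⟩) ih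
        simp only [hmul, f, cX.map_one, Hom.map_one, hX.mul_one] at h
        rwa [show SelfSimilarClosure.mk (u :: b) = hY.mul (SelfSimilarClosure.of u)
          (SelfSimilarClosure.mk b) from (SelfSimilarClosure.mul_mk [u] b).symm]
    refine (Submonoid.eq_top_iff' _).2 ?_
    rintro ⟨⟨a⟩, ⟨b⟩⟩
    -- Uses `(a, b) = (a, 1)(1, b)`.
    have h := Submonoid.mul_mem _ (mem_left a) (mem_right b)
    simp only [hmul, σ.act_one, hX.mul_one, hY.one_mul] at h
    exact h

end SemidirectProduct

end LAlgebra

theorem mainTheorem3 {X : Type u} {Y : Type v} [LAlgebra X] [LAlgebra Y]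
    (ρ : LAlgebra.Operation Y X) :
    (∃! σ : LAlgebra.Operation (LAlgebra.SelfSimilarClosure Y) (LAlgebra.SelfSimilarClosure X),
      σ.Extends ρ) ∧
    (∀ σ : LAlgebra.Operation (LAlgebra.SelfSimilarClosure Y) (LAlgebra.SelfSimilarClosure X),
      σ.Extends ρ →
        LAlgebra.IsSelfSimilarClosure
          (fun p : LAlgebra.SemidirectProduct ρ =>
            (⟨LAlgebra.SelfSimilarClosure.of p.fst, LAlgebra.SelfSimilarClosure.of p.snd⟩ :
              LAlgebra.SemidirectProduct σ)) ∧
        ∃! e : LAlgebra.Iso (LAlgebra.SelfSimilarClosure (LAlgebra.SemidirectProduct ρ))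
            (LAlgebra.SemidirectProduct σ),
          ∀ p : LAlgebra.SemidirectProduct ρ,
            e.toEquiv (LAlgebra.SelfSimilarClosure.of p) =
              ⟨LAlgebra.SelfSimilarClosure.of p.fst, LAlgebra.SelfSimilarClosure.of p.snd⟩) ∧
    (LAlgebra.IsSelfSimilar (LAlgebra.SemidirectProduct ρ) ↔
      LAlgebra.IsSelfSimilar X ∧ LAlgebra.IsSelfSimilar Y) := by
  exact ⟨ρ.existsUnique_extends,
    fun _ hσ => ⟨LAlgebra.SemidirectProduct.isSelfSimilarClosure hσ,
      (LAlgebra.SemidirectProduct.isSelfSimilarClosure hσ).existsUnique_iso⟩,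
    LAlgebra.SemidirectProduct.isSelfSimilar_iff⟩
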